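/- **Theorem 5.5.** Let $G$ be a finite simple graph and let $f\ge 1$. Consider the following game. The firefighters first choose an orientation of $G$, i.e. each edge $uv$ is replaced by exactly one of the arcs $\overrightarrow{uv}$, $\overrightarrow{vu}$. Then a fire breaks out at a vertex of $G$ chosen by the opponent. After that, repeatedly, the firefighters permanently protect at most $f$ vertices that are not burning, and then the fire spreads from every burning vertex, along its outgoing arcs, to all unprotected out-neighbours; burning vertices stay burning. Let $\overrightarrow{\beta}(G,f)$ be the number of vertices that eventually burn under optimal play; that is, the minimum over all orientations of $G$ of the maximum over all starting vertices of the minimum, over all strategies of the firefighters, of the number of vertices that burn. If $G$ is a finite simple graph of maximum degree at most $3$, then $$\overrightarrow{\beta}(G,1)\le 2 .$$ The bound is best possible: the complete graph $K_4$ and the Petersen graph both have maximum degree $3$, and $\overrightarrow{\beta}(K_4,1)=\overrightarrow{\beta}(\text{Petersen graph},1)=2$. -/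

import Mathlib

namespace OrientedFirefighter

/-- `D` is an orientation of the simple graph `G`: every edge `uv` of `G` is given exactly one of
the two arcs `u → v`, `v → u`, and there are no other arcs (in particular no loops). -/
structure IsOrientation {V : Type*} (D : Digraph V) (G : SimpleGraph V) : Prop where
  adj_iff : ∀ u v, G.Adj u v ↔ D.Adj u v ∨ D.Adj v u
  asymm : ∀ u v, D.Adj u v → ¬ D.Adj v u

/-- The set of vertices that have burnt after `t` propagation steps, when the fire breaks out at
`v` in the digraph `D` and, after the `t`-th propagation step, the firefighters protect the
vertices of `σ t`. At step `t + 1` the fire spreads along outgoing arcs to every vertex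
that has not been protected so far (protection is permanent). -/
def burntAt {V : Type*} (D : Digraph V) (σ : ℕ → Finset V) (v : V) : ℕ → Set V
  | 0 => {v}
  | t + 1 => burntAt D σ v t ∪
      {w | (∃ u ∈ burntAt D σ v t, D.Adj u w) ∧ ∀ s ≤ t, w ∉ σ s}

/-- All vertices that eventually burn. -/
def burnt {V : Type*} (D : Digraph V) (σ : ℕ → Finset V) (v : V) : Set V :=
  ⋃ t, burntAt D σ v t

/-- `σ` is a legal play of `f` firefighters against a fire breaking out at `v`: each time, at most
`f` vertices are protected, none of them already burning. (The spread of the fire is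
deterministic, so a strategy against a fire at `v` is a sequence of protected sets.) -/
def IsStrategy {V : Type*} (D : Digraph V) (f : ℕ) (v : V) (σ : ℕ → Finset V) : Prop :=
  ∀ t, (σ t).card ≤ f ∧ ∀ w ∈ σ t, w ∉ burntAt D σ v t

/-- The least number of vertices that burn in `D` when the fire breaks out at `v`, over all
strategies of `f` firefighters. -/
noncomputable def betaFrom {V : Type*} (D : Digraph V) (f : ℕ) (v : V) : ℕ∞ :=
  ⨅ (σ : ℕ → Finset V) (_ : IsStrategy D f v σ), (burnt D σ v).encard

/-- `β(D, f)`: the number of vertices of the digraph `D` that burn under optimal play of `f`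
firefighters, for the worst choice of the vertex where the fire breaks out. -/
noncomputable def betaDigraph {V : Type*} (D : Digraph V) (f : ℕ) : ℕ∞ :=
  ⨆ v : V, betaFrom D f v

/-- The oriented firefighter number of `G`: the minimum of `β(D, f)` over all orientations `D`
of `G`. The orientation is fixed before the fire breaks out. -/
noncomputable def orientedBeta {V : Type*} (G : SimpleGraph V) (f : ℕ) : ℕ∞ :=
  ⨅ (D : Digraph V) (_ : IsOrientation D G), betaDigraph D f

/-- The Petersen graph: the vertices are the 2-element subsets of a 5-element set, and two of them
are adjacent when they are disjoint. -/
def petersenGraph : SimpleGraph {s : Finset (Fin 5) // s.card = 2} where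
  Adj s t := Disjoint s.1 t.1
  symm := ⟨fun _ _ h => h.symm⟩
  loopless := ⟨fun s h => by
    have h1 : s.1 = ∅ := by simpa using h
    have h2 := s.2
    simp [h1] at h2⟩

instance : DecidableRel petersenGraph.Adj := fun s t =>
  inferInstanceAs (Decidable (Disjoint s.1 t.1))

end OrientedFirefighter

/-!
Upper bound. List the vertices greedily: the next vertex is an unlisted neighbour of the current one
if there is one, and otherwise any unlisted vertex (`exists_greedy_numbering`). Then a vertex with
a neighbour that comes later in the list is adjacent to its immediate successor. Orient an edge
between consecutive vertices backwards and every other edge forwards (`greedyDigraph`). A vertex `v`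
has at most one backward arc. If it has a forward arc, it also has an incoming arc
from its successor, which uses up one of its at most three edges. So if `v` has out-degree more than
`1`, it has a forward arc `v → w`, and at most one further out-neighbour. As `w` has an incoming arc
from `v`, it cannot have out-degree more than `1`: it would have a forward arc, hence a second
incoming arc, from its successor. The firefighters therefore protect
the other out-neighbour of `v`, let `w` burn, and then protect the only out-neighbour of `w`
(`betaFrom_le_two`).

Lower bound. In an orientation of a nonempty cubic graph the average out-degree is `3 / 2`, so
some vertex has two out-neighbours, only one of which can be protected before the fire spreads
(`two_le_orientedBeta`).
-/

namespace OrientedFirefighter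

/-- The set of out-neighbours of a vertex. -/
noncomputable def outNeighbors {V : Type*} [Fintype V] (D : Digraph V) (v : V) : Finset V :=
  by classical exact Finset.univ.filter (D.Adj v)

theorem mem_outNeighbors {V : Type*} [Fintype V] {D : Digraph V} {v w : V} :
    w ∈ outNeighbors D v ↔ D.Adj v w := by
  simp [outNeighbors]

/-- With `w` among the out-neighbours of `v`, this is the play that sacrifices `w`; the case
`w = v` is the play that stops the fire at once. -/
theorem betaFrom_le_two {V : Type*} [Fintype V] [DecidableEq V] {D : Digraph V}
    (hD : ∀ u v, D.Adj u v → ¬ D.Adj v u) {v w : V} (hw : w = v ∨ D.Adj v w)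
    (hv1 : ((outNeighbors D v).erase w).card ≤ 1) (hw1 : (outNeighbors D w).card ≤ 1) :
    betaFrom D 1 v ≤ 2 := by
  let σ : ℕ → Finset V := fun t =>
    if t = 0 then (outNeighbors D v).erase w else if t = 1 then outNeighbors D w else ∅
  have hirr : ∀ u, ¬ D.Adj u u := fun u h => hD u u h h
  have hsub : ∀ t, burntAt D σ v t ⊆ {v, w} := by
    intro t
    induction t with
    | zero => intro x hx; exact Or.inl hx
    | succ t ih =>
      rintro x (hx | ⟨⟨u, hu, hux⟩, hs⟩)
      · exact ih hx
      · by_contra hxn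
        have hxw : x ≠ w := fun h => hxn (Or.inr h)
        have h0 : x ∉ (outNeighbors D v).erase w := by simpa [σ] using hs 0 (Nat.zero_le t)
        have key : ¬ D.Adj v x := fun h =>
          h0 (Finset.mem_erase.2 ⟨hxw, mem_outNeighbors.2 h⟩)
        rcases t with _ | t
        · rw [show u = v from hu] at hux
          exact key hux
        · rcases ih hu with h | h
          · exact key (h ▸ hux)
          · have h1 : x ∉ outNeighbors D w := by simpa [σ] using hs 1 (by omega)
            rw [show u = w from h] at hux
            exact h1 (mem_outNeighbors.2 hux)
  have hσ : IsStrategy D 1 v σ := by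
    intro t
    have hdisj : v ∉ σ t ∧ w ∉ σ t := by
      simp only [σ]
      split_ifs
      · simp [mem_outNeighbors, hirr]
      · simp only [mem_outNeighbors, hirr, not_false_eq_true, and_true]
        rcases hw with rfl | hw
        · exact hirr _
        · exact hD _ _ hw
      · simp
    refine ⟨?_, fun x hx hb => ?_⟩
    · simp only [σ]
      split_ifs
      · exact hv1
      · exact hw1
      · simp
    · rcases hsub t hb with h | h
      · exact hdisj.1 (h ▸ hx)
      · exact hdisj.2 (h ▸ hx)
  calc betaFrom D 1 v ≤ (burnt D σ v).encard := iInf₂_le σ hσ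
    _ ≤ ({v, w} : Set V).encard := Set.encard_le_encard (Set.iUnion_subset hsub)
    _ ≤ 2 := by
      refine (Set.encard_insert_le _ _).trans ?_
      rw [Set.encard_singleton, one_add_one_eq_two]

/-- Numbering of a finite set `S` from a given vertex, choosing greedily a neighbour of the current
vertex as its successor. -/
theorem exists_greedy_numbering_on {V : Type*} (G : SimpleGraph V) (n : ℕ) :
    ∀ (S : Finset V) (v : V), v ∈ S → S.card = n + 1 →
      ∃ f : V → ℕ, f v = 0 ∧ Set.InjOn f S ∧
        ∀ u ∈ S, ∀ w ∈ S, G.Adj u w → f u < f w → ∃ c ∈ S, G.Adj u c ∧ f c = f u + 1 := by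
  classical
  induction n with
  | zero =>
    intro S v hv hS
    obtain ⟨a, rfl⟩ := Finset.card_eq_one.1 hS
    refine ⟨fun _ => 0, rfl, by simp, ?_⟩
    intro u _ w _ _ h
    exact absurd h (lt_irrefl _)
  | succ n ih =>
    intro S v hv hS
    have hcard : (S.erase v).card = n + 1 := by rw [Finset.card_erase_of_mem hv]; omega
    obtain ⟨v', hv', hgreedy⟩ : ∃ v' ∈ S.erase v, (∃ w ∈ S, G.Adj v w) → G.Adj v v' := by
      by_cases h : ∃ w ∈ S, G.Adj v w
      · obtain ⟨w, hwS, hw⟩ := h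
        exact ⟨w, Finset.mem_erase.2 ⟨hw.ne', hwS⟩, fun _ => hw⟩
      · obtain ⟨x, hx⟩ : (S.erase v).Nonempty := Finset.card_pos.1 (by omega)
        exact ⟨x, hx, fun h' => absurd h' h⟩
    obtain ⟨f, hf0, hinj, hf⟩ := ih (S.erase v) v' hv' hcard
    refine ⟨fun x => if x = v then 0 else f x + 1, by simp, ?_, ?_⟩
    · intro x hx y hy hxy
      by_cases hxv : x = v <;> by_cases hyv : y = v <;> simp [hxv, hyv] at hxy ⊢
      exact hinj (by simpa [hxv] using hx) (by simpa [hyv] using hy) hxy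
    · intro u hu w hw huw hlt
      by_cases huv : u = v
      · subst huv
        refine ⟨v', Finset.mem_of_mem_erase hv', hgreedy ⟨w, hw, huw⟩, ?_⟩
        simp [Finset.ne_of_mem_erase hv', hf0]
      · have hwv : w ≠ v := by rintro rfl; simp at hlt
        simp only [huv, hwv, if_false, add_lt_add_iff_right] at hlt
        obtain ⟨c, hc, huc, hfc⟩ := hf u (Finset.mem_erase.2 ⟨huv, hu⟩) w
          (Finset.mem_erase.2 ⟨hwv, hw⟩) huw hlt
        refine ⟨c, Finset.mem_of_mem_erase hc, huc, ?_⟩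
        simp [huv, Finset.ne_of_mem_erase hc, hfc]

theorem exists_greedy_numbering {V : Type*} [Fintype V] (G : SimpleGraph V) :
    ∃ f : V → ℕ, Function.Injective f ∧
      ∀ u w, G.Adj u w → f u < f w → ∃ c, G.Adj u c ∧ f c = f u + 1 := by
  rcases isEmpty_or_nonempty V with hV | ⟨⟨v⟩⟩
  · exact ⟨fun _ => 0, Function.injective_of_subsingleton _, fun u => hV.elim u⟩
  · have hpos : 0 < (Finset.univ : Finset V).card := Finset.card_pos.2 ⟨v, Finset.mem_univ v⟩
    obtain ⟨f, -, hinj, hf⟩ := exists_greedy_numbering_on G ((Finset.univ : Finset V).card - 1)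
      Finset.univ v (Finset.mem_univ v) (by omega)
    refine ⟨f, fun x y h => hinj (by simp) (by simp) h, fun u w huw hlt => ?_⟩
    obtain ⟨c, -, hc⟩ := hf u (Finset.mem_univ u) w (Finset.mem_univ w) huw hlt
    exact ⟨c, hc⟩

/-- The orientation of `G` along a numbering `f` of its vertices: edges between consecutive vertices
point backwards, all others forwards. -/
def greedyDigraph {V : Type*} (G : SimpleGraph V) (f : V → ℕ) : Digraph V where
  Adj u w := G.Adj u w ∧ (f u = f w + 1 ∨ f u + 1 < f w)

theorem greedyDigraph_isOrientation {V : Type*} (G : SimpleGraph V) {f : V → ℕ}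
    (hf : Function.Injective f) : IsOrientation (greedyDigraph G f) G where
  adj_iff u v := by
    constructor
    · intro h
      have hne : f u ≠ f v := fun e => h.ne (hf e)
      have hcases : (f u = f v + 1 ∨ f u + 1 < f v) ∨ (f v = f u + 1 ∨ f v + 1 < f u) := by omega
      exact hcases.imp (fun h' => ⟨h, h'⟩) (fun h' => ⟨h.symm, h'⟩)
    · rintro (h | h)
      · exact h.1
      · exact h.1.symm
  asymm u v h h' := by
    have h1 := h.2
    have h2 := h'.2
    omega

/-- Two out-neighbours cannot both be the immediate predecessor, so one of them comes later,
and then the numbering makes the immediate successor a neighbour. -/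
theorem exists_forward_arc {V : Type*} [Fintype V] {G : SimpleGraph V} {f : V → ℕ}
    (hinj : Function.Injective f)
    (hf : ∀ u w, G.Adj u w → f u < f w → ∃ c, G.Adj u c ∧ f c = f u + 1) {v : V}
    (hv : 1 < (outNeighbors (greedyDigraph G f) v).card) :
    ∃ w c, G.Adj v w ∧ f v + 1 < f w ∧ G.Adj v c ∧ f c = f v + 1 := by
  obtain ⟨a, ha, b, hb, hab⟩ := Finset.one_lt_card.1 hv
  rw [mem_outNeighbors] at ha hb
  have hne : f a ≠ f b := fun e => hab (hinj e)
  obtain ⟨w, hvw, hlt⟩ : ∃ w, G.Adj v w ∧ f v + 1 < f w := by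
    rcases ha.2 with h1 | h1
    · rcases hb.2 with h2 | h2
      · omega
      · exact ⟨b, hb.1, h2⟩
    · exact ⟨a, ha.1, h1⟩
  obtain ⟨c, hc⟩ := hf v w hvw (by omega)
  exact ⟨w, c, hvw, hlt, hc⟩

theorem card_le_one_of_pair_disjoint {V : Type*} [Fintype V] [DecidableEq V] {G : SimpleGraph V}
    [DecidableRel G.Adj] (hG : G.maxDegree ≤ 3) {v a b : V} {S : Finset V} (hab : a ≠ b)
    (ha : G.Adj v a) (hb : G.Adj v b) (haS : a ∉ S) (hbS : b ∉ S) (hS : ∀ x ∈ S, G.Adj v x) :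
    S.card ≤ 1 := by
  have hsub : insert a (insert b S) ⊆ G.neighborFinset v := by
    intro x hx
    simp only [Finset.mem_insert] at hx
    rw [SimpleGraph.mem_neighborFinset]
    rcases hx with rfl | rfl | hx
    exacts [ha, hb, hS x hx]
  have h1 := Finset.card_le_card hsub
  rw [Finset.card_insert_of_notMem (by simp [hab, haS]), Finset.card_insert_of_notMem hbS,
    SimpleGraph.card_neighborFinset_eq_degree] at h1
  have h2 := G.degree_le_maxDegree v
  omega

theorem orientedBeta_le_two {V : Type*} [Fintype V] (G : SimpleGraph V) [DecidableRel G.Adj]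
    (hG : G.maxDegree ≤ 3) : orientedBeta G 1 ≤ 2 := by
  classical
  obtain ⟨f, hinj, hf⟩ := exists_greedy_numbering G
  have hD := greedyDigraph_isOrientation G hinj
  unfold orientedBeta
  refine (iInf₂_le (greedyDigraph G f) hD).trans (iSup_le fun v => ?_)
  by_cases hv : (outNeighbors (greedyDigraph G f) v).card ≤ 1
  · exact betaFrom_le_two hD.asymm (Or.inl rfl) ((Finset.card_erase_le).trans hv) hv
  obtain ⟨w, c, hvw, hlt, hvc, hc⟩ := exists_forward_arc hinj hf (not_le.1 hv)
  refine betaFrom_le_two hD.asymm (w := w) (Or.inr ⟨hvw, Or.inr hlt⟩) ?_ ?_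
  · refine card_le_one_of_pair_disjoint hG (a := w) (b := c) ?_ hvw hvc (by simp) ?_ ?_
    · rintro rfl; omega
    · intro h
      have h' := (mem_outNeighbors.1 (Finset.mem_of_mem_erase h)).2
      omega
    · intro x hx
      exact (mem_outNeighbors.1 (Finset.mem_of_mem_erase hx)).1
  · by_contra hw
    obtain ⟨-, d, -, -, hwd, hd⟩ := exists_forward_arc hinj hf (not_le.1 hw)
    refine hw (card_le_one_of_pair_disjoint hG (a := v) (b := d) ?_ hvw.symm hwd ?_ ?_ ?_)
    · rintro rfl; omega
    · intro h
      have h' := (mem_outNeighbors.1 h).2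
      omega
    · intro h
      have h' := (mem_outNeighbors.1 h).2
      omega
    · intro x hx
      exact (mem_outNeighbors.1 hx).1

theorem two_le_betaFrom {V : Type*} [Fintype V] {D : Digraph V} {v : V} (hv : ¬ D.Adj v v)
    (h : 1 < (outNeighbors D v).card) : 2 ≤ betaFrom D 1 v := by
  refine le_iInf₂ fun σ hσ => ?_
  obtain ⟨x, hx, hxσ⟩ := Finset.exists_mem_notMem_of_card_lt_card (lt_of_le_of_lt (hσ 0).1 h)
  rw [mem_outNeighbors] at hx
  have hne : v ≠ x := by rintro rfl; exact hv hx
  rw [← Set.encard_pair hne]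
  refine Set.encard_le_encard ?_
  rintro y (rfl | rfl)
  · exact Set.mem_iUnion.2 ⟨0, rfl⟩
  · refine Set.mem_iUnion.2 ⟨1, Or.inr ⟨⟨v, rfl, hx⟩, fun s hs => ?_⟩⟩
    rwa [Nat.le_zero.1 hs]

/-- Otherwise all out-degrees would be at most `1`, although twice their sum is the sum of the
degrees. -/
theorem two_le_orientedBeta {V : Type*} [Fintype V] [Nonempty V] (G : SimpleGraph V)
    [DecidableRel G.Adj] (hG : ∀ v, G.degree v = 3) : 2 ≤ orientedBeta G 1 := by
  classical
  refine le_iInf₂ fun D hD => ?_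
  obtain ⟨v, hv⟩ : ∃ v, 1 < (outNeighbors D v).card := by
    by_contra! hle
    have hdeg : ∀ v, G.degree v ≤ (outNeighbors D v).card +
        (Finset.univ.filter fun u => D.Adj u v).card := by
      intro v
      rw [← SimpleGraph.card_neighborFinset_eq_degree]
      refine (Finset.card_le_card fun u hu => ?_).trans (Finset.card_union_le _ _)
      simpa [mem_outNeighbors] using (hD.adj_iff v u).1 (by simpa using hu)
    have hswap : ∑ v, (Finset.univ.filter fun u => D.Adj u v).card =
        ∑ v, (outNeighbors D v).card := by
      simp only [outNeighbors, Finset.card_filter]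
      exact Finset.sum_comm
    have hsum := Finset.sum_le_sum fun v (_ : v ∈ Finset.univ) => hdeg v
    rw [Finset.sum_add_distrib, hswap] at hsum
    have hle' := Finset.sum_le_sum fun v (_ : v ∈ Finset.univ) => hle v
    simp only [hG, Finset.sum_const, Finset.card_univ, smul_eq_mul] at hsum hle'
    have hpos : 0 < Fintype.card V := Fintype.card_pos
    omega
  exact (two_le_betaFrom (fun h => hD.asymm v v h h) hv).trans (le_iSup (betaFrom D 1) v)

theorem maxDegree_eq_and_orientedBeta_eq {V : Type*} [Fintype V] [Nonempty V] (G : SimpleGraph V)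
    [DecidableRel G.Adj] (hG : ∀ v, G.degree v = 3) :
    G.maxDegree = 3 ∧ orientedBeta G 1 = 2 := by
  have hmax : G.maxDegree = 3 :=
    SimpleGraph.IsRegularOfDegree.maxDegree_eq G hG
  exact ⟨hmax, le_antisymm (orientedBeta_le_two G hmax.le) (two_le_orientedBeta G hG)⟩

theorem petersenGraph_degree (v) : petersenGraph.degree v = 3 := by
  revert v
  decide +kernel

end OrientedFirefighter

theorem theorem5p5 :
    (∀ (V : Type*) [Fintype V] (G : SimpleGraph V) [DecidableRel G.Adj],
      G.maxDegree ≤ 3 → OrientedFirefighter.orientedBeta G 1 ≤ 2) ∧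
    ((⊤ : SimpleGraph (Fin 4)).maxDegree = 3 ∧
      OrientedFirefighter.orientedBeta (⊤ : SimpleGraph (Fin 4)) 1 = 2) ∧
    (OrientedFirefighter.petersenGraph.maxDegree = 3 ∧
      OrientedFirefighter.orientedBeta OrientedFirefighter.petersenGraph 1 = 2) := by
  refine ⟨fun V _ G _ hG => OrientedFirefighter.orientedBeta_le_two G hG, ?_, ?_⟩
  · exact OrientedFirefighter.maxDegree_eq_and_orientedBeta_eq _ (by decide)
  · have : Nonempty {s : Finset (Fin 5) // s.card = 2} := ⟨⟨{0, 1}, rfl⟩⟩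
    exact OrientedFirefighter.maxDegree_eq_and_orientedBeta_eq _
      OrientedFirefighter.petersenGraph_degree
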